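/- Let $n,m\ge 1$ and consider the general system of $n+m$ bilinear equations on $\mathbb P^n\times\mathbb P^m$, $$F_k=\sum_{i=0}^n\sum_{j=0}^m a^{(k)}_{i,j}\,x_i y_j=0,\qquad 1\le k\le n+m,$$ with indeterminate coefficients $a^{(k)}_{i,j}$. Its discriminant $\Delta\in\mathbb Z[a^{(k)}_{i,j}]$ is the irreducible polynomial with coprime integer coefficients (unique up to sign) that vanishes at every complex specialization of the coefficients for which the system has a multiple solution, i.e. a solution $(x,y)\in\mathbb P^n(\mathbb C)\times\mathbb P^m(\mathbb C)$ at which the $(n+m)\times(n+m+2)$ Jacobian matrix of $(F_1,\dots,F_{n+m})$ with respect to all the variables $x_0,\dots,x_n,y_0,\dots,y_m$ has rank less than $n+m$ (equivalently, at which the Jacobian determinant in affine coordinates vanishes). Let $M$ be the $(m+n)(n+1)\times(m+1)$ matrix over $\mathbb Z[a^{(k)}_{i,j}]$ with rows indexed by the pairs $(i,j)$, $1\le i\le m+n$, $0\le j\le n$, whose row $(i,j)$ consists of the coefficients of $y_0,\dots,y_m$ in the partial derivative $\partial F_i/\partial x_j$, which is a linear form in $y$. Then $\Delta$ belongs to the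 ideal of $\mathbb Z[a^{(k)}_{i,j}]$ generated by the maximal, i.e. $(m+1)\times(m+1)$, minors of $M$. -/

import Mathlib

/-- The indices `(k, i, j)` of the coefficients `a^{(k)}_{i,j}` of a system of `n + m` bilinear
forms in `x_0, …, x_n` and `y_0, …, y_m`. -/
abbrev CoeffIdx (n m : ℕ) : Type := Fin (n + m) × Fin (n + 1) × Fin (m + 1)

/-- The variables `x_0, …, x_n` (left summand) and `y_0, …, y_m` (right summand). -/
abbrev XYVar (n m : ℕ) : Type := Fin (n + 1) ⊕ Fin (m + 1)

/-- The form `F_k = ∑ i, ∑ j, a^{(k)}_{i,j} x_i y_j` of the bilinear system with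
coefficients `a`. -/
noncomputable def bilinForm {R : Type*} [CommRing R] {n m : ℕ} (a : CoeffIdx n m → R)
    (k : Fin (n + m)) : MvPolynomial (XYVar n m) R :=
  ∑ i : Fin (n + 1), ∑ j : Fin (m + 1),
    MvPolynomial.C (a (k, i, j)) * MvPolynomial.X (Sum.inl i) * MvPolynomial.X (Sum.inr j)

/-- The Jacobian matrix of the system at `(x, y)`, with respect to all the homogeneous
coordinates. -/
noncomputable def jacobianAt {R : Type*} [CommRing R] {n m : ℕ} (a : CoeffIdx n m → R)
    (x : Fin (n + 1) → R) (y : Fin (m + 1) → R) : Matrix (Fin (n + m)) (XYVar n m) R :=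
  Matrix.of fun k v =>
    MvPolynomial.eval (Sum.elim x y) (MvPolynomial.pderiv v (bilinForm a k))

/-- The complex bilinear system with coefficients `a` has a multiple (that is, singular) solution
`([x], [y])` in `ℙⁿ × ℙᵐ`. By Euler's relations in `x` and in `y`, at a solution with
`x_0 ≠ 0` and `y_0 ≠ 0` the rank below is the rank of the square affine Jacobian matrix, formed
by the derivatives with respect to `x_1, …, x_n, y_1, …, y_m`; likewise in the other charts. -/
def HasMultipleSolution {n m : ℕ} (a : CoeffIdx n m → ℂ) : Prop :=
  ∃ (x : Fin (n + 1) → ℂ) (y : Fin (m + 1) → ℂ), x ≠ 0 ∧ y ≠ 0 ∧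
    (∀ k, MvPolynomial.eval (Sum.elim x y) (bilinForm a k) = 0) ∧
    (jacobianAt a x y).rank < n + m

/-- `Δ` is the discriminant of the general bilinear system: an irreducible polynomial in the
coefficients, over `ℤ` (so that, not being constant, it has coprime integer coefficients), which
vanishes whenever the system has a multiple solution. For `n, m ≥ 1` such a polynomial is unique
up to sign, because the systems with a multiple solution form an irreducible hypersurface. -/
def IsDiscriminant {n m : ℕ} (Δ : MvPolynomial (CoeffIdx n m) ℤ) : Prop :=
  Irreducible Δ ∧ ∀ a : CoeffIdx n m → ℂ, HasMultipleSolution a → MvPolynomial.aeval a Δ = 0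

/-- The `(m + n)(n + 1) × (m + 1)` matrix of the partial derivatives `∂F_i/∂x_j` of the general
system, whose coefficients are the variables of `ℤ[a]`: the row `(i, j)` lists the coefficients
of `y_0, …, y_m` in `∂F_i/∂x_j`. -/
noncomputable def derivMatrix (n m : ℕ) :
    Matrix (Fin (n + m) × Fin (n + 1)) (Fin (m + 1)) (MvPolynomial (CoeffIdx n m) ℤ) :=
  Matrix.of fun r l =>
    MvPolynomial.coeff (Finsupp.single (Sum.inr l) 1)
      (MvPolynomial.pderiv (Sum.inl r.2) (bilinForm (n := n) (m := m) MvPolynomial.X r.1))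

/-- The ideal generated by the maximal minors of a matrix with `c` columns and
rows indexed by `ι` (of which there are at least `c`). -/
def maximalMinorIdeal {R ι : Type*} [CommRing R] {c : ℕ} (M : Matrix ι (Fin c) R) : Ideal R :=
  Ideal.span (Set.range fun r : Fin c ↪ ι => (M.submatrix r id).det)

/-! The entries of the derivative matrix are distinct variables. If a specialization of it kills
some y ≠ 0, then every (x, y) is a multiple solution; hence Δ vanishes at every complex matrix with
a nonzero kernel. It remains to see that integer polynomials with this property lie in the ideal of
maximal minors.

Give the entry (i, l) the weight `ρ i * l`, with ρ injective and positive. By rearrangement, the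
heaviest term of a minor, its rows ordered by ρ, is the diagonal one, with coefficient ±1. So
division works over ℤ once every heaviest monomial A of such a polynomial P is divisible by a
diagonal one (`VanishesOnRankDeficient.exists_chain`). Otherwise a greedy search for a diagonal
fails, and A avoids an open staircase of entries. A curve of rank-deficient matrices, rescaled by
the weights, tends to any matrix with nonzero entries whose staircase is replaced by zero. In the
limit the heaviest part of P vanishes there, although it contains A. -/

/-! ### Staircases and their convex partial sums -/

section Thresholds

/-- If no chain of rows of strictly increasing height meets the relation `S` in all of the columns
`0, …, c - 1`, then `S` avoids the open staircase cut out by a sequence of thresholds. -/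
theorem exists_thresholds {ι : Type*} [Finite ι] (ρ : ι → ℕ) (c : ℕ) (S : ι → ℕ → Prop)
    (h : ¬ ∃ r : Fin c → ι, StrictMono (ρ ∘ r) ∧ ∀ l : Fin c, S (r l) l) :
    ∃ T : ℕ → ℕ, Monotone T ∧ T 0 = 0 ∧ (∀ i, ρ i < T c) ∧
      (∀ i l, S i l → T l < ρ i → T (l + 1) ≤ ρ i) ∧
      ∀ i l, T (l + 1) = ρ i → T (l + 1) < T (l + 2) := by
  obtain ⟨N, hN⟩ := Set.finite_range ρ |>.bddAbove
  have hN' : ∀ i, ρ i < N + 1 := fun i => Nat.lt_succ_of_le (hN ⟨i, rfl⟩)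
  generalize N + 1 = M at hN'
  -- Greedy search: the next threshold is the least height above the current one of a row meeting S
  -- in column l, or M, above all heights, if there is none.
  let T : ℕ → ℕ := fun l => Nat.rec 0
    (fun l t => sInf {v | v = M ∨ ∃ i, ρ i = v ∧ S i l ∧ t < v}) l
  have hmem : ∀ l, T (l + 1) = M ∨ ∃ i, ρ i = T (l + 1) ∧ S i l ∧ T l < T (l + 1) := fun l =>
    Nat.sInf_mem (s := {v | v = M ∨ ∃ i, ρ i = v ∧ S i l ∧ T l < v}) ⟨M, Or.inl rfl⟩
  have hle : ∀ l v, (v = M ∨ ∃ i, ρ i = v ∧ S i l ∧ T l < v) → T (l + 1) ≤ v := fun l v hv =>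
    Nat.sInf_le (s := {v | v = M ∨ ∃ i, ρ i = v ∧ S i l ∧ T l < v}) hv
  have hM : ∀ l, T l ≤ M := fun l => by
    cases l with
    | zero => exact Nat.zero_le _
    | succ l => exact hle l M (Or.inl rfl)
  have hmono : Monotone T := monotone_nat_of_le_succ fun l => by
    rcases hmem l with h1 | ⟨i, -, -, h1⟩
    · rw [h1]; exact hM l
    · exact h1.le
  have hc : T c = M := by
    by_contra hne
    have hlt : T c < M := lt_of_le_of_ne (hM c) hne
    have hrow : ∀ l : Fin c, ∃ i, ρ i = T (l + 1) ∧ S i l ∧ T l < T (l + 1) := fun l => by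
      rcases hmem l with h1 | h1
      · have := hmono (show (l : ℕ) + 1 ≤ c from l.2)
        omega
      · exact h1
    choose r hr1 hr2 hr3 using hrow
    refine h ⟨r, fun a b hab => ?_, hr2⟩
    have h1 : T (a + 1) ≤ T b := hmono (show (a : ℕ) + 1 ≤ b from hab)
    have h2 := hr3 b
    simp only [Function.comp_apply, hr1]
    omega
  refine ⟨T, hmono, rfl, fun i => hc ▸ hN' i, fun i l hS hT => hle l _ (Or.inr ⟨i, rfl, hS, hT⟩),
    fun i l hT => ?_⟩
  rcases hmem (l + 1) with h1 | ⟨-, -, -, h1⟩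
  · rw [h1, hT]; exact hN' i
  · exact h1

/-- The partial sums of the thresholds. -/
def thresholdSum (T : ℕ → ℕ) (l : ℕ) : ℕ := ∑ t ∈ Finset.range l, T (t + 1)

theorem thresholdSum_succ (T : ℕ → ℕ) (l : ℕ) :
    thresholdSum T (l + 1) = thresholdSum T l + T (l + 1) := Finset.sum_range_succ _ _

/-- The function l ↦ `thresholdSum T l` - v * l has the increasing slopes T (l + 1) - v, so it is
convex and decreases up to j. Both sides are arranged to avoid subtraction in ℕ. -/
theorem thresholdSum_lt_of_lt {T : ℕ → ℕ} (hT : Monotone T) {v j l : ℕ} (hj : T j < v)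
    (hl : l < j) : v * l + thresholdSum T j < v * j + thresholdSum T l := by
  induction j, hl using Nat.le_induction with
  | base =>
    rw [Nat.succ_eq_add_one] at hj ⊢
    rw [thresholdSum_succ, mul_add]; omega
  | succ k hk ih =>
    have := ih ((hT k.le_succ).trans_lt hj)
    rw [thresholdSum_succ, mul_add]; omega

theorem thresholdSum_lt_of_gt {T : ℕ → ℕ} (hT : Monotone T) {v j l : ℕ} (hj : v < T (j + 1))
    (hl : j < l) : v * l + thresholdSum T j < v * j + thresholdSum T l := by
  induction l, hl using Nat.le_induction with
  | base =>
    rw [thresholdSum_succ, Nat.succ_eq_add_one, mul_add]; omega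
  | succ k hk ih =>
    have : T (j + 1) ≤ T (k + 1) := hT (by omega)
    rw [thresholdSum_succ, mul_add]; omega

/-- The column in which the staircase of the thresholds `T` passes the height `v`. -/
theorem exists_threshold_column {T : ℕ → ℕ} {c : ℕ} (h0 : T 0 = 0) {v : ℕ} (hv : 0 < v)
    (hc : v ≤ T c) : ∃ j < c, T j < v ∧ v ≤ T (j + 1) := by
  classical
  have hex : ∃ k, v ≤ T k := ⟨c, hc⟩
  obtain ⟨j, hj⟩ : ∃ j, Nat.find hex = j + 1 := Nat.exists_eq_succ_of_ne_zero fun h => by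
    have := Nat.find_spec hex
    rw [h, h0] at this
    omega
  have h1 := Nat.find_spec hex
  have h2 := Nat.find_min' hex hc
  have h3 := Nat.find_min hex (m := j) (by omega)
  rw [hj] at h1 h2
  exact ⟨j, by omega, by omega, h1⟩

theorem thresholdSum_le {T : ℕ → ℕ} (hT : Monotone T) {v j : ℕ} (hj : T j < v)
    (hj' : v ≤ T (j + 1)) (l : ℕ) : v * l + thresholdSum T j ≤ v * j + thresholdSum T l := by
  rcases lt_trichotomy l j with h | rfl | h
  · exact (thresholdSum_lt_of_lt hT hj h).le
  · exact le_rfl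
  · induction l, h using Nat.le_induction with
    | base => rw [thresholdSum_succ, Nat.succ_eq_add_one, mul_add]; omega
    | succ k hk ih =>
      have : T (j + 1) ≤ T (k + 1) := hT (by omega)
      rw [thresholdSum_succ, mul_add]; omega

/-- The convex function attains its minimum at j; the only possible tie is at j + 1, when the slope
T (j + 1) - v is zero. -/
theorem thresholdSum_lt {T : ℕ → ℕ} (hT : Monotone T) {v j : ℕ} (hj : T j < v)
    (hj' : v ≤ T (j + 1)) (hv : T (j + 1) = v → v < T (j + 2)) {l : ℕ} (hl : l ≠ j)
    (hl' : l = j + 1 → v ≠ T (j + 1)) :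
    v * l + thresholdSum T j < v * j + thresholdSum T l := by
  rcases hl.lt_or_gt with h | h
  · exact thresholdSum_lt_of_lt hT hj h
  rcases hj'.lt_or_eq with h1 | h1
  · exact thresholdSum_lt_of_gt hT h1 h
  · have h2 : j + 1 ≠ l := fun h2 => hl' h2.symm h1
    have h3 := thresholdSum_lt_of_gt hT (hv h1.symm) (lt_of_le_of_ne h h2)
    rw [thresholdSum_succ, mul_add] at h3
    omega

end Thresholds

/-! ### Degeneration of rank-deficient matrices -/

section Curve

variable {ι : Type*}

/-- A curve of matrices whose member at `s ≠ 0` has, after rescaling the entry `(i, l)` by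
`s ^ (ρ i * l)`, rank less than the number `c` of columns. At `s = 0` it is the matrix `b` with the
entries in the open staircase of the thresholds `T` replaced by zero. -/
theorem exists_rank_deficient_curve {ρ : ι → ℕ} (hρ : Function.Injective ρ)
    (hpos : ∀ i, 0 < ρ i) {c : ℕ} {T : ℕ → ℕ} (hT : Monotone T) (h0 : T 0 = 0)
    (hc : ∀ i, ρ i < T c) (hT' : ∀ i l, T (l + 1) = ρ i → T (l + 1) < T (l + 2))
    (b : ι → ℕ → ℂ) (hb : ∀ i l, b i l ≠ 0) :
    ∃ L : ℂ → ι → ℕ → ℂ, (∀ i l, Continuous fun s => L s i l) ∧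
      (∀ i, ∀ l < c, L 0 i l = if T l < ρ i ∧ ρ i < T (l + 1) then 0 else b i l) ∧
      ∀ s ≠ 0, ∃ y : ℕ → ℂ, (∀ l, y l ≠ 0) ∧
        ∀ i, ∑ l ∈ Finset.range c, L s i l * (s ^ (ρ i * l))⁻¹ * y l = 0 := by
  classical
  -- In the row of height T (l + 1), unique by injectivity of ρ, columns l and l + 1 tie at s = 0; u
  -- makes their contributions cancel.
  obtain ⟨u, hu0, hu⟩ : ∃ u : ℕ → ℂ, (∀ l, u l ≠ 0) ∧
      ∀ i l, ρ i = T (l + 1) → u (l + 1) * b i (l + 1) = - (u l * b i l) := by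
    let u : ℕ → ℂ := fun l => Nat.rec 1
      (fun l t => if h : ∃ i, ρ i = T (l + 1) then -(t * b h.choose l) / b h.choose (l + 1) else t) l
    have hs : ∀ l, u (l + 1) = if h : ∃ i, ρ i = T (l + 1) then
        -(u l * b h.choose l) / b h.choose (l + 1) else u l := fun l => rfl
    refine ⟨u, fun l => ?_, fun i l hi => ?_⟩
    · induction l with
      | zero => exact one_ne_zero
      | succ l ih =>
        rw [hs]
        split_ifs with h
        · exact div_ne_zero (neg_ne_zero.2 (mul_ne_zero ih (hb _ _))) (hb _ _)
        · exact ih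
    · have h : ∃ i, ρ i = T (l + 1) := ⟨i, hi⟩
      have hi' : h.choose = i := hρ (h.choose_spec.trans hi.symm)
      rw [hs, dif_pos h, hi', div_mul_cancel₀ _ (hb _ _)]
  choose j hjc hj1 hj2 using fun i => exists_threshold_column h0 (hpos i) (hc i).le
  let E := thresholdSum T
  -- With the kernel vector u l * s ^ E l, solving row i for its entry in column j i yields these
  -- exponents of s.
  let δ : ι → ℕ → ℕ := fun i l => (ρ i * j i + E l) - (ρ i * l + E (j i))
  have hδ : ∀ i l, δ i l + (ρ i * l + E (j i)) = ρ i * j i + E l := fun i l =>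
    Nat.sub_add_cancel (thresholdSum_le hT (hj1 i) (hj2 i) l)
  refine ⟨fun s i l => if l = j i then
    -∑ k ∈ (Finset.range c).erase (j i), u k / u (j i) * b i k * s ^ δ i k else b i l,
    fun i l => ?_, fun i l hl => ?_, fun s hs => ⟨fun l => u l * s ^ E l,
      fun l => mul_ne_zero (hu0 l) (pow_ne_zero _ hs), fun i => ?_⟩⟩
  · by_cases h : l = j i
    · simp only [h, if_true]; fun_prop
    · simp only [h, if_false]; fun_prop
  · have hδ0 : ∀ k, k ≠ j i → (k = j i + 1 → ρ i ≠ T (j i + 1)) → δ i k ≠ 0 := fun k h1 h2 => by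
      have := thresholdSum_lt hT (hj1 i) (hj2 i) (fun h => h ▸ hT' i _ h) h1 h2
      exact (Nat.sub_pos_of_lt this).ne'
    by_cases h : l = j i
    · subst h
      simp only [if_true]
      by_cases h1 : ρ i < T (j i + 1)
      · rw [if_pos ⟨hj1 i, h1⟩, Finset.sum_eq_zero, neg_zero]
        intro k hk
        rw [zero_pow (hδ0 k (Finset.ne_of_mem_erase hk) fun _ => h1.ne), mul_zero]
      -- The tie: only column j i + 1 survives at s = 0, and the choice of u turns it into b i (j
      -- i).
      · have h2 : ρ i = T (j i + 1) := le_antisymm (hj2 i) (not_lt.1 h1)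
        have h3 : j i + 1 < c := by
          refine lt_of_le_of_ne (hjc i) fun h => ?_
          have := hc i
          rw [← h] at this
          omega
        have h4 : δ i (j i + 1) = 0 := by
          have := hδ i (j i + 1)
          simp only [E, thresholdSum_succ, mul_add] at this
          omega
        rw [if_neg fun h => h1 h.2, Finset.sum_eq_single (j i + 1), h4, pow_zero, mul_one,
          div_mul_eq_mul_div, hu i _ h2, neg_div, neg_neg, mul_div_cancel_left₀ _ (hu0 _)]
        · intro k hk hk'
          rw [zero_pow (hδ0 k (Finset.ne_of_mem_erase hk) fun h => absurd h hk'), mul_zero]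
        · intro h
          exact absurd (Finset.mem_erase.2 ⟨by omega, Finset.mem_range.2 h3⟩) h
    · simp only [if_neg h]
      rw [if_neg]
      rintro ⟨h1, h2⟩
      rcases lt_or_gt_of_ne h with h3 | h3
      · have := hT (show l + 1 ≤ j i from h3)
        have := hj1 i
        omega
      · have := hT (show j i + 1 ≤ l from h3)
        have := hj2 i
        omega
  · rw [← Finset.add_sum_erase _ _ (Finset.mem_range.2 (hjc i))]
    simp only [if_true, neg_mul, Finset.sum_mul]
    rw [neg_add_eq_zero]
    refine Finset.sum_congr rfl fun k hk => ?_
    rw [if_neg (Finset.ne_of_mem_erase hk)]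
    have h1 := hu0 (j i)
    have h2 : s ^ δ i k * (s ^ (ρ i * k) * s ^ E (j i)) = s ^ (ρ i * j i) * s ^ E k := by
      rw [← pow_add, ← pow_add, ← pow_add, hδ]
    field_simp
    linear_combination u k * b i k * h2

end Curve

/-! ### The ideal of maximal minors of a generic matrix -/

section Generic

open MvPolynomial Matrix

variable {ι : Type*} {c : ℕ}

/-- The polynomial `P` in the entries of a matrix vanishes at every complex matrix with a nonzero
kernel. -/
def VanishesOnRankDeficient (P : MvPolynomial (ι × Fin c) ℤ) : Prop :=
  ∀ B : Matrix ι (Fin c) ℂ, (∃ y ≠ 0, B *ᵥ y = 0) → aeval (fun p : ι × Fin c => B p.1 p.2) P = 0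

/-- The weight of a monomial in the entries of a matrix, the entry `(i, l)` having the
weight `ρ i * l`. -/
noncomputable def entryWeight (ρ : ι → ℕ) : (ι × Fin c →₀ ℕ) →+ ℕ :=
  Finsupp.weight fun p : ι × Fin c => ρ p.1 * (p.2 : ℕ)

/-- The matrix whose entries are distinct variables. -/
noncomputable def genericMatrix (ι : Type*) (c : ℕ) :
    Matrix ι (Fin c) (MvPolynomial (ι × Fin c) ℤ) :=
  Matrix.of fun i l => X (i, l)

/-- Multiplying the value of P along the rescaled curve by s ^ d clears the poles; continuity
carries its vanishing to s = 0, where only weight d survives. -/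
theorem VanishesOnRankDeficient.sum_support_eq_zero [Fintype ι] {P : MvPolynomial (ι × Fin c) ℤ}
    (hP : VanishesOnRankDeficient P) (hc0 : 0 < c) {ρ : ι → ℕ} {d : ℕ}
    (hd : ∀ A ∈ P.support, entryWeight ρ A ≤ d)
    (hρ : Function.Injective ρ) (hpos : ∀ i, 0 < ρ i) {T : ℕ → ℕ} (hT : Monotone T) (h0 : T 0 = 0)
    (hc : ∀ i, ρ i < T c) (hT' : ∀ i l, T (l + 1) = ρ i → T (l + 1) < T (l + 2))
    (b : ι → ℕ → ℂ) (hb : ∀ i l, b i l ≠ 0) :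
    ∑ A ∈ P.support, ((P.coeff A : ℤ) : ℂ) * 0 ^ (d - entryWeight ρ A) *
      ∏ p : ι × Fin c, (if T p.2 < ρ p.1 ∧ ρ p.1 < T (p.2 + 1) then 0 else b p.1 p.2) ^ A p = 0 := by
  obtain ⟨L, hLc, hL0, hL⟩ := exists_rank_deficient_curve hρ hpos hT h0 hc hT' b hb
  let G : ℂ → ℂ := fun s => ∑ A ∈ P.support, ((P.coeff A : ℤ) : ℂ) * s ^ (d - entryWeight ρ A) *
      ∏ p : ι × Fin c, L s p.1 p.2 ^ A p
  have hGc : Continuous G := by fun_prop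
  have hG : ∀ s ≠ 0, G s = 0 := fun s hs => by
    obtain ⟨y, hy0, hy⟩ := hL s hs
    have h1 := hP (Matrix.of fun i l => L s i l * (s ^ (ρ i * l))⁻¹) ⟨fun l => y l,
      fun h => hy0 0 (congrFun h ⟨0, hc0⟩), by
        ext i
        simp only [mulVec, dotProduct, Matrix.of_apply, Pi.zero_apply]
        exact (Fin.sum_univ_eq_sum_range (fun l => L s i l * (s ^ (ρ i * l))⁻¹ * y l) c).trans
          (hy i)⟩
    rw [aeval_def, eval₂_eq'] at h1
    have h2 : G s = s ^ d * 0 := by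
      rw [← h1, Finset.mul_sum]
      refine Finset.sum_congr rfl fun A hA => ?_
      have h3 : ∏ p : ι × Fin c, (s ^ (ρ p.1 * (p.2 : ℕ))) ^ A p = s ^ entryWeight ρ A := by
        simp only [entryWeight, Finsupp.weight_eq_sum, ← pow_mul, Finset.prod_pow_eq_pow_sum,
          smul_eq_mul, mul_comm (A _)]
      have h4 : s ^ d = s ^ (d - entryWeight ρ A) * s ^ entryWeight ρ A := by
        rw [← pow_add, Nat.sub_add_cancel (hd A hA)]
      have h5 := pow_ne_zero (entryWeight ρ A) hs
      simp only [Matrix.of_apply, mul_pow, inv_pow, Finset.prod_mul_distrib, Finset.prod_inv_distrib,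
        h3, h4, algebraMap_int_eq, eq_intCast]
      field_simp
    rw [h2, mul_zero]
  have hG0 : G 0 = 0 := by
    have : G = fun _ => 0 := hGc.ext_on (dense_compl_singleton (0 : ℂ)) continuous_const
      fun s hs => hG s hs
    rw [this]
  refine Eq.trans (Finset.sum_congr rfl fun A _ => ?_) hG0
  congr 1
  refine Finset.prod_congr rfl fun p _ => ?_
  rw [hL0 p.1 p.2 p.2.2]

/-- The initial monomials of a polynomial that vanishes at the matrices with a nonzero kernel are
divisible by diagonal monomials. -/
theorem VanishesOnRankDeficient.exists_chain [Fintype ι] {P : MvPolynomial (ι × Fin c) ℤ}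
    (hP : VanishesOnRankDeficient P) (hc0 : 0 < c) {ρ : ι → ℕ} (hρ : Function.Injective ρ)
    (hpos : ∀ i, 0 < ρ i) {A : ι × Fin c →₀ ℕ} (hA : A ∈ P.support)
    (hd : ∀ A' ∈ P.support, entryWeight ρ A' ≤ entryWeight ρ A) :
    ∃ r : Fin c → ι, StrictMono (ρ ∘ r) ∧ ∀ l, A (r l, l) ≠ 0 := by
  classical
  by_contra hno
  obtain ⟨T, hT, h0, hc, hS, hT'⟩ := exists_thresholds ρ c
    (fun i l => ∃ h : l < c, A (i, ⟨l, h⟩) ≠ 0) fun ⟨r, hr, hr'⟩ => hno ⟨r, hr, fun l => (hr' l).2⟩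
  let Z : ι × Fin c → Prop := fun p => T p.2 < ρ p.1 ∧ ρ p.1 < T (p.2 + 1)
  let good : (ι × Fin c →₀ ℕ) → Prop := fun A' =>
    entryWeight ρ A' = entryWeight ρ A ∧ ∀ p, Z p → A' p = 0
  let Q : MvPolynomial (ι × Fin c) ℂ :=
    ∑ A' ∈ P.support with good A', monomial A' ((P.coeff A' : ℤ) : ℂ)
  -- The curve requires nonzero entries; the product of the variables covers the remaining points.
  have hQ : Q * ∏ p : ι × Fin c, (X p : MvPolynomial (ι × Fin c) ℂ) = 0 := by
    refine MvPolynomial.funext fun b => ?_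
    rw [map_mul, map_zero, map_prod]
    by_cases hb : ∀ p, b p ≠ 0
    · convert zero_mul _
      have h1 := hP.sum_support_eq_zero hc0 hd hρ hpos hT h0 hc hT'
        (fun i l => if h : l < c then b (i, ⟨l, h⟩) else 1) fun i l => by
          split_ifs
          · exact hb _
          · exact one_ne_zero
      rw [← h1, map_sum, Finset.sum_filter]
      refine Finset.sum_congr rfl fun A' hA' => ?_
      simp only [Fin.is_lt, dif_pos, Fin.eta, Prod.mk.eta]
      split_ifs with hg
      · rw [hg.1, Nat.sub_self, pow_zero, mul_one, eval_monomial, Finsupp.prod_fintype]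
        · congr 1
          refine Finset.prod_congr rfl fun p _ => ?_
          split_ifs with hp
          · rw [hg.2 p hp, pow_zero, pow_zero]
          · rfl
        · exact fun _ => pow_zero _
      · by_cases h2 : entryWeight ρ A' = entryWeight ρ A
        · obtain ⟨p, hp, hp'⟩ : ∃ p, Z p ∧ A' p ≠ 0 := by
            by_contra! h3
            exact hg ⟨h2, h3⟩
          rw [Finset.prod_eq_zero (Finset.mem_univ p), mul_zero]
          rw [if_pos hp, zero_pow hp']
        · have := hd A' hA'
          rw [zero_pow (by omega), mul_zero, zero_mul]
    · push Not at hb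
      obtain ⟨p, hp⟩ := hb
      rw [Finset.prod_eq_zero (Finset.mem_univ p), mul_zero]
      rw [eval_X, hp]
  have hQ0 : Q = 0 := (mul_eq_zero.1 hQ).resolve_right
    (Finset.prod_ne_zero_iff.2 fun p _ => X_ne_zero p)
  have hgood : good A := by
    refine ⟨rfl, fun p hp => ?_⟩
    by_contra h
    have := hS p.1 p.2 ⟨p.2.2, h⟩ hp.1
    have := hp.2
    omega
  have h1 : Q.coeff A = ((P.coeff A : ℤ) : ℂ) := by
    rw [coeff_sum, Finset.sum_eq_single A, coeff_monomial, if_pos rfl]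
    · intro A' _ h
      rw [coeff_monomial, if_neg h]
    · intro h
      exact absurd (Finset.mem_filter.2 ⟨hA, hgood⟩) h
  rw [hQ0, coeff_zero, eq_comm, Int.cast_eq_zero] at h1
  exact mem_support_iff.1 hA h1

/-- The exponent of the term of the minor with rows `r` that belongs to the permutation `τ`. -/
noncomputable def minorExponent (r : Fin c → ι) (τ : Equiv.Perm (Fin c)) : ι × Fin c →₀ ℕ :=
  ∑ l, Finsupp.single (r (τ l), l) 1

theorem entryWeight_minorExponent (ρ : ι → ℕ) (r : Fin c → ι) (τ : Equiv.Perm (Fin c)) :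
    entryWeight ρ (minorExponent r τ) = ∑ l, ρ (r (τ l)) * (l : ℕ) := by
  simp [entryWeight, minorExponent, Finsupp.weight_single]

/-- Strict rearrangement inequality: equality would make τ increasing, hence the identity. -/
theorem entryWeight_minorExponent_lt {ρ : ι → ℕ} {r : Fin c → ι} (hr : StrictMono (ρ ∘ r))
    {τ : Equiv.Perm (Fin c)} (hτ : τ ≠ 1) :
    entryWeight ρ (minorExponent r τ) < entryWeight ρ (minorExponent r 1) := by
  rw [entryWeight_minorExponent, entryWeight_minorExponent]
  have h1 : Monovary (ρ ∘ r) (fun l : Fin c => (l : ℕ)) := fun a b hab => (hr hab).le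
  refine (h1.sum_comp_perm_mul_lt_sum_mul_iff (σ := τ)).2 fun h2 => hτ ?_
  have h3 : StrictMono τ := fun a b hab => by
    have h4 : (ρ ∘ r) (τ a) ≤ (ρ ∘ r) (τ b) := h2 (i := a) (j := b) hab
    exact lt_of_le_of_ne (hr.le_iff_le.1 h4) fun h => hab.ne (τ.injective h)
  exact Equiv.ext fun l => le_antisymm (h3.le_id l) (h3.id_le l)

theorem det_genericMatrix_submatrix (r : Fin c → ι) :
    ((genericMatrix ι c).submatrix r id).det =
      ∑ τ : Equiv.Perm (Fin c), monomial (minorExponent r τ) (Equiv.Perm.sign τ : ℤ) := by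
  rw [det_apply]
  refine Finset.sum_congr rfl fun τ _ => ?_
  rw [minorExponent, monomial_sum_index, ← smul_eq_C_mul, Units.smul_def]
  rfl

/-- One division step: subtracting a multiple of the minor with rows r leaves only lighter terms. -/
theorem monomial_mem_sup {ρ : ι → ℕ} {A : ι × Fin c →₀ ℕ}
    {r : Fin c → ι} (hr : StrictMono (ρ ∘ r)) (hA : ∀ l, A (r l, l) ≠ 0) (a : ℤ) :
    monomial A a ∈ (maximalMinorIdeal (genericMatrix ι c)).restrictScalars ℤ ⊔
      restrictSupport ℤ {A' | entryWeight ρ A' < entryWeight ρ A} := by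
  classical
  have hle : minorExponent r 1 ≤ A := by
    intro p
    simp only [minorExponent, Finsupp.coe_finsetSum, Finset.sum_apply, Finsupp.single_apply,
      Equiv.Perm.one_apply]
    by_cases hp : (r p.2, p.2) = p
    · rw [Finset.sum_eq_single p.2, if_pos hp]
      · have := hA p.2
        rw [hp] at this
        omega
      · intro l _ hl
        exact if_neg fun h => hl (congrArg Prod.snd h)
      · intro h
        exact absurd (Finset.mem_univ _) h
    · rw [Finset.sum_eq_zero]
      · exact Nat.zero_le _
      · intro l _
        refine if_neg fun h => hp ?_
        have : l = p.2 := congrArg Prod.snd h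
        rwa [this] at h
  obtain ⟨C, rfl⟩ := exists_add_of_le hle
  have h1 : monomial (minorExponent r 1 + C) a =
      monomial C a * ((genericMatrix ι c).submatrix r id).det -
        ∑ τ ∈ Finset.univ.erase (1 : Equiv.Perm (Fin c)),
          monomial (C + minorExponent r τ) (a * (Equiv.Perm.sign τ : ℤ)) := by
    rw [det_genericMatrix_submatrix, Finset.mul_sum, ← Finset.add_sum_erase _ _ (Finset.mem_univ 1)]
    simp only [monomial_mul, add_sub_cancel_right, Equiv.Perm.sign_one, Units.val_one, mul_one,
      add_comm C]
  rw [h1]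
  refine Submodule.sub_mem _ (Submodule.mem_sup_left ?_) (Submodule.mem_sup_right ?_)
  · exact Ideal.mul_mem_left _ _ (Ideal.subset_span ⟨⟨r, hr.injective.of_comp⟩, rfl⟩)
  · refine Submodule.sum_mem _ fun τ hτ => (monomial_mem_restrictSupport ℤ).2 (Or.inl ?_)
    have := entryWeight_minorExponent_lt hr (Finset.ne_of_mem_erase hτ)
    simp only [Set.mem_ofPred_eq, map_add]
    omega

theorem vanishesOnRankDeficient_of_mem {P : MvPolynomial (ι × Fin c) ℤ}
    (hP : P ∈ maximalMinorIdeal (genericMatrix ι c)) : VanishesOnRankDeficient P := by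
  rintro B ⟨y, hy0, hy⟩
  let φ := aeval (R := ℤ) (fun p : ι × Fin c => B p.1 p.2)
  suffices h : maximalMinorIdeal (genericMatrix ι c) ≤ RingHom.ker φ from h hP
  refine Ideal.span_le.2 ?_
  rintro _ ⟨r, rfl⟩
  rw [SetLike.mem_coe, RingHom.mem_ker, AlgHom.map_det]
  refine exists_mulVec_eq_zero_iff.1 ⟨y, hy0, ?_⟩
  ext l
  refine Eq.trans ?_ (congrFun hy (r l))
  simp [mulVec, dotProduct, genericMatrix, φ]

/-- The maximal minors of a generic matrix generate the ideal of all the polynomials with integer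
coefficients that vanish at the complex matrices with a nonzero kernel. -/
theorem VanishesOnRankDeficient.mem_maximalMinorIdeal [Fintype ι] {P : MvPolynomial (ι × Fin c) ℤ}
    (hP : VanishesOnRankDeficient P) (hc0 : 0 < c) :
    P ∈ maximalMinorIdeal (genericMatrix ι c) := by
  classical
  obtain ⟨ρ, hρ, hpos⟩ : ∃ ρ : ι → ℕ, Function.Injective ρ ∧ ∀ i, 0 < ρ i :=
    ⟨fun i => Fintype.equivFin ι i + 1, fun i j h => (Fintype.equivFin ι).injective
      (Fin.ext (Nat.succ_injective h)), fun i => Nat.succ_pos _⟩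
  suffices h : ∀ d, ∀ P : MvPolynomial (ι × Fin c) ℤ, VanishesOnRankDeficient P →
      P ∈ restrictSupport ℤ {A | entryWeight ρ A < d} →
      P ∈ maximalMinorIdeal (genericMatrix ι c) from
    h (P.support.sup (entryWeight ρ) + 1) P hP fun A hA => Nat.lt_succ_of_le (Finset.le_sup hA)
  intro d
  induction d with
  | zero =>
    intro P _ hd
    have : P = 0 := by
      rw [← support_eq_empty, Finset.eq_empty_iff_forall_notMem]
      exact fun A hA => Nat.not_lt_zero _ (hd hA)
    exact this ▸ Ideal.zero_mem _
  | succ d ih =>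
    intro P hP hd
    have h1 : P ∈ (maximalMinorIdeal (genericMatrix ι c)).restrictScalars ℤ ⊔
        restrictSupport ℤ {A | entryWeight ρ A < d} := by
      rw [P.as_sum]
      refine Submodule.sum_mem _ fun A hA => ?_
      rcases (Nat.lt_succ_iff.1 (hd hA)).lt_or_eq with h2 | h2
      · exact Submodule.mem_sup_right ((monomial_mem_restrictSupport ℤ).2 (Or.inl h2))
      · obtain ⟨r, hr, hr'⟩ := hP.exists_chain hc0 hρ hpos hA
          fun A' hA' => h2 ▸ Nat.lt_succ_iff.1 (hd hA')
        exact h2 ▸ monomial_mem_sup hr hr' _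
    -- The remainder R still vanishes on rank-deficient matrices, since Q does.
    obtain ⟨Q, hQ, R, hR, rfl⟩ := Submodule.mem_sup.1 h1
    refine Ideal.add_mem _ hQ (ih R (fun B hB => ?_) hR)
    have h3 := hP B hB
    rwa [map_add, vanishesOnRankDeficient_of_mem hQ B hB, zero_add] at h3

end Generic

/-! ### Bilinear systems and their discriminant -/

section Bilinear

open MvPolynomial Matrix

variable {R : Type*} [CommRing R] {n m : ℕ}

theorem pderiv_inl_bilinForm (a : CoeffIdx n m → R) (k : Fin (n + m)) (i : Fin (n + 1)) :
    pderiv (Sum.inl i) (bilinForm a k) = ∑ j, C (a (k, i, j)) * X (Sum.inr j) := by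
  classical
  simp [bilinForm, pderiv_X, Pi.single_apply]
  exact Finset.sum_congr rfl fun _ _ => mul_comm _ _

theorem pderiv_inr_bilinForm (a : CoeffIdx n m → R) (k : Fin (n + m)) (j : Fin (m + 1)) :
    pderiv (Sum.inr j) (bilinForm a k) = ∑ i, C (a (k, i, j)) * X (Sum.inl i) := by
  classical
  simp [bilinForm, pderiv_X, Pi.single_apply]

theorem derivMatrix_apply (k : Fin (n + m)) (i : Fin (n + 1)) (j : Fin (m + 1)) :
    derivMatrix n m (k, i) j = X (k, i, j) := by
  classical
  simp [derivMatrix, pderiv_inl_bilinForm, coeff_sum, coeff_C_mul, coeff_X,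
    Finsupp.single_left_inj]

/-- If all the derivatives in the variables `x` vanish at some `y ≠ 0`, then every `(x, y)` is a
multiple solution. -/
theorem hasMultipleSolution_of_kernel (hn : 1 ≤ n) (a : CoeffIdx n m → ℂ) (y : Fin (m + 1) → ℂ)
    (hy0 : y ≠ 0) (hy : ∀ k i, ∑ j, a (k, i, j) * y j = 0) : HasMultipleSolution a := by
  refine ⟨fun _ => 1, y, fun h => one_ne_zero (congrFun h 0), hy0, fun k => ?_, ?_⟩
  · simp [bilinForm, hy]
  -- The x-columns of the Jacobian vanish and its y-columns form N, which kills y; so its rank is at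
  -- most m < n + m.
  · let N : Matrix (Fin (n + m)) (Fin (m + 1)) ℂ := Matrix.of fun k j => ∑ i, a (k, i, j)
    have hJ : jacobianAt a (fun _ => 1) y = N * Matrix.of fun (j : Fin (m + 1)) (v : XYVar n m) =>
        Sum.elim (fun _ => (0 : ℂ)) (fun j' => if j = j' then 1 else 0) v := by
      ext k v
      rcases v with i | j
      · simp [jacobianAt, pderiv_inl_bilinForm, hy, mul_apply]
      · simp [jacobianAt, pderiv_inr_bilinForm, N, mul_apply]
    have hN : N *ᵥ y = 0 := by
      ext k
      simp only [N, mulVec, dotProduct, Matrix.of_apply, Finset.sum_mul, Pi.zero_apply]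
      rw [Finset.sum_comm]
      exact Finset.sum_eq_zero fun i _ => hy k i
    have hrank : N.rank < m + 1 := by
      have h1 := LinearMap.finrank_range_add_finrank_ker N.mulVecLin
      have h2 : 0 < Module.finrank ℂ (LinearMap.ker N.mulVecLin) :=
        Module.finrank_pos_iff_exists_ne_zero.2 ⟨⟨y, hN⟩, fun h => hy0 (congrArg Subtype.val h)⟩
      rw [Module.finrank_fin_fun] at h1
      rw [Matrix.rank]
      omega
    have := rank_mul_le_left N (Matrix.of fun (j : Fin (m + 1)) (v : XYVar n m) =>
      Sum.elim (fun _ => (0 : ℂ)) (fun j' => if j = j' then 1 else 0) v)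
    rw [hJ]
    omega

end Bilinear

open MvPolynomial in
theorem theorem1 (n m : ℕ) (hn : 1 ≤ n) (hm : 1 ≤ m) (Δ : MvPolynomial (CoeffIdx n m) ℤ)
    (hΔ : IsDiscriminant Δ) : Δ ∈ maximalMinorIdeal (derivMatrix n m) := by
  let e := Equiv.prodAssoc (Fin (n + m)) (Fin (n + 1)) (Fin (m + 1))
  have h1 : rename e.symm Δ ∈
      maximalMinorIdeal (genericMatrix (Fin (n + m) × Fin (n + 1)) (m + 1)) := by
    refine VanishesOnRankDeficient.mem_maximalMinorIdeal ?_ m.succ_pos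
    rintro B ⟨y, hy0, hy⟩
    rw [aeval_rename]
    exact hΔ.2 _ (hasMultipleSolution_of_kernel hn _ y hy0 fun k i => congrFun hy (k, i))
  have h2 := Ideal.mem_map_of_mem (rename (R := ℤ) e) h1
  rw [rename_rename, e.self_comp_symm, rename_id_apply, maximalMinorIdeal, Ideal.map_span] at h2
  refine Ideal.span_mono ?_ h2
  rintro _ ⟨_, ⟨r, rfl⟩, rfl⟩
  refine ⟨r, ?_⟩
  rw [AlgHom.map_det]
  refine congrArg Matrix.det (Matrix.ext fun l j => ?_)
  simp [genericMatrix, derivMatrix_apply (r l).1 (r l).2 j, e]
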